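/- Let $G$ be a finite group with derived subgroup $G'$, and let $\mathrm{Irr}(G)$ be the set of complex irreducible characters of $G$. Call $\chi\in\mathrm{Irr}(G)$ *primitive* if $\chi$ is not of the form $\theta^G$ (the induced character) for any character $\theta$ of a proper subgroup of $G$, and *quasi-primitive* if for every normal subgroup $N$ of $G$ the restriction $\chi_N$ is a multiple of an irreducible character of $N$. Let $\mathrm{Irr}_{\mathrm{pri}}(G)$ and $\mathrm{Irr}_{\mathrm{qua}}(G)$ denote the sets of primitive and of quasi-primitive irreducible characters of $G$. Then $|G:G'|$ divides $|\mathrm{Irr}_{\mathrm{pri}}(G)|$ and $|\mathrm{Irr}_{\mathrm{qua}}(G)|$, and hence it divides $\gcd\bigl(|\mathrm{Irr}_{\mathrm{pri}}(G)|,|\mathrm{Irr}_{\mathrm{qua}}(G)|\bigr)$. -/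

import Mathlib

namespace FinChar

/-- A complex character of `G`: the trace function of a finite-dimensional complex
representation. Every such representation is, in a basis, one on some `ℂⁿ`. -/
def IsCharacter {G : Type*} [Group G] (χ : G → ℂ) : Prop :=
  ∃ (n : ℕ) (ρ : Representation ℂ G (Fin n → ℂ)), ρ.character = χ

/-- `Irr(G)`: the set of characters afforded by irreducible complex representations. -/
def Irr (G : Type*) [Group G] : Set (G → ℂ) :=
  {χ | ∃ (n : ℕ) (ρ : Representation ℂ G (Fin n → ℂ)), ρ.IsIrreducible ∧ ρ.character = χ}

/-- The restriction `χ_H` of a function on `G` to a subgroup `H`. -/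
def res {G : Type*} [Group G] (H : Subgroup G) (χ : G → ℂ) : H → ℂ :=
  fun h => χ h

open Classical in
/-- The function `θ°` on `G` that agrees with `θ` on `H` and vanishes off `H`. -/
noncomputable def extendZero {G : Type*} [Group G] (H : Subgroup G) (θ : H → ℂ) (g : G) : ℂ :=
  if h : g ∈ H then θ ⟨g, h⟩ else 0

/-- The induced class function
`θ^G(g) = |H|⁻¹ ∑_{x ∈ G} θ°(x g x⁻¹)`. -/
noncomputable def ind {G : Type*} [Group G] [Fintype G] (H : Subgroup G) (θ : H → ℂ) : G → ℂ :=
  fun g => (Nat.card H : ℂ)⁻¹ * ∑ x : G, extendZero H θ (x * g * x⁻¹)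

/-- The set of primitive irreducible characters: those not of the form `θ^G` for any character
`θ` of a proper subgroup. -/
def IrrPri (G : Type*) [Group G] [Fintype G] : Set (G → ℂ) :=
  {χ | χ ∈ Irr G ∧
    ∀ H : Subgroup G, H ≠ ⊤ → ∀ θ : H → ℂ, IsCharacter θ → χ ≠ ind H θ}

/-- The set of quasi-primitive irreducible characters: those whose restriction to every normal
subgroup `N` is a multiple of an irreducible character of `N`. -/
def IrrQua (G : Type*) [Group G] : Set (G → ℂ) :=
  {χ | χ ∈ Irr G ∧
    ∀ N : Subgroup G, N.Normal → ∃ ψ ∈ Irr N, ∃ a : ℕ, res N χ = a • ψ}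

/-- A finite group has finitely many irreducible characters, so that the cardinalities of
`IrrPri G` and `IrrQua G` are genuine ones. -/
theorem irr_finite (G : Type*) [Group G] [Finite G] : (Irr G).Finite := by
  classical
  have := Fintype.ofFinite G
  have hne : (Nat.card G : ℂ) ≠ 0 := by exact_mod_cast Nat.card_pos.ne'
  have := invertibleOfNonzero hne
  have key : ∀ χ ∈ Irr G, ∀ ψ ∈ Irr G,
      (Nat.card G : ℂ)⁻¹ * ∑ g : G, χ g * ψ g⁻¹ = if χ = ψ then 1 else 0 := by
    rintro χ ⟨n, ρ, hρ, rfl⟩ ψ ⟨m, σ, hσ, rfl⟩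
    rw [Representation.char_orthonormal ρ σ]
    by_cases h : Nonempty (Representation.Equiv σ ρ)
    · obtain ⟨φ⟩ := id h
      simp [h, Representation.char_iso φ]
    · rw [if_neg h, if_neg]
      intro he
      apply h
      have h1 := Representation.char_orthonormal ρ σ
      have h2 := Representation.char_orthonormal ρ ρ
      rw [← he, h2, if_neg h, if_pos ⟨Representation.Equiv.refl ρ⟩] at h1
      exact absurd h1 one_ne_zero
  have hli : LinearIndependent ℂ (fun χ : Irr G => (χ : G → ℂ)) := by
    rw [linearIndependent_iff']
    intro s c hc ψ hψ
    have h0 : ∑ χ ∈ s, c χ *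
        ((Nat.card G : ℂ)⁻¹ * ∑ g : G, (χ : G → ℂ) g * (ψ : G → ℂ) g⁻¹) = 0 := by
      have : ∀ g, ∑ χ ∈ s, c χ * (χ : G → ℂ) g = 0 := fun g => by
        simpa using congrFun hc g
      calc _ = (Nat.card G : ℂ)⁻¹ *
            ∑ g : G, (∑ χ ∈ s, c χ * (χ : G → ℂ) g) * (ψ : G → ℂ) g⁻¹ := by
              simp only [Finset.sum_mul, Finset.mul_sum]
              rw [Finset.sum_comm]
              refine Finset.sum_congr rfl fun g _ => Finset.sum_congr rfl fun χ _ => ?_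
              ring
        _ = 0 := by simp [this]
    rw [Finset.sum_congr rfl fun χ _ => by rw [key χ χ.2 ψ ψ.2]] at h0
    simpa [Subtype.coe_inj, hψ] using h0
  exact hli.setFinite

theorem irrPri_finite (G : Type*) [Group G] [Fintype G] : (IrrPri G).Finite :=
  (irr_finite G).subset fun _ h => h.1

theorem irrQua_finite (G : Type*) [Group G] [Finite G] : (IrrQua G).Finite :=
  (irr_finite G).subset fun _ h => h.1

end FinChar

/-! The linear characters of `G` form a group of order `|G : G'|` that acts on `Irr G` by
multiplication. This action preserves `IrrPri G` and `IrrQua G`, so it suffices that it is free on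
both sets.

Let `l * χ = χ`, so that `χ` vanishes off `l.ker`. If `χ` is quasi-primitive, replace `l ≠ 1` by a
power of prime order `p`; comparing norms on `G` and on the kernel makes the index `p` a square,
which is absurd. If `χ` is primitive, an isomorphism `T` from a representation affording `χ` to its
twist has eigenspaces that `G` permutes through `l`. Hence `χ` is induced from `l.ker`, and
primitivity forces `l.ker = ⊤`. -/

namespace FinChar

/-! ### Free actions and the number of linear characters -/

section FreeAction

/-- A group acting freely on a finite set has order dividing that of the set. -/
theorem card_dvd_ncard_of_free {A X : Type*} [Group A] (S : Set X) (act : A → X → X)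
    (h1 : ∀ x, act 1 x = x) (hmul : ∀ a b x, act (a * b) x = act a (act b x))
    (hS : ∀ a, ∀ x ∈ S, act a x ∈ S) (hfree : ∀ a, ∀ x ∈ S, act a x = x → a = 1) :
    Nat.card A ∣ S.ncard := by
  let _ : MulAction A S :=
    { smul := fun a x => ⟨act a x, hS a x x.2⟩
      one_smul := fun x => Subtype.ext (h1 x)
      mul_smul := fun a b x => Subtype.ext (hmul a b x) }
  have hst : ∀ x : S, MulAction.stabilizer A x = ⊥ := by
    intro x
    rw [eq_bot_iff]
    intro a ha
    exact hfree a x x.2 (congrArg Subtype.val (MulAction.mem_stabilizer_iff.1 ha))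
  rw [← Nat.card_coe_set_eq, Nat.card_congr (MulAction.selfEquivOrbitsQuotientProd hst),
    Nat.card_prod]
  exact dvd_mul_left _ _

/-- A finite group `G` has exactly `|G : G'|` linear characters. -/
theorem card_linearCharacters (G : Type*) [Group G] [Finite G] :
    Nat.card (G →* ℂˣ) = (commutator G).index := by
  rw [Nat.card_congr (Abelianization.lift (G := G) (A := ℂˣ))]
  exact CommGroup.card_monoidHom_of_hasEnoughRootsOfUnity (Abelianization G) ℂ

end FreeAction

/-! ### Multiplication by linear characters -/

section Twist

variable {G V : Type*} [Group G] [AddCommGroup V] [Module ℂ V]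

/-- The product of a function on `G` with a linear character. -/
noncomputable def twist (l : G →* ℂˣ) (χ : G → ℂ) : G → ℂ := fun g => (l g : ℂ) * χ g

/-- The tensor product of a representation with a linear character. -/
noncomputable def twistRep (l : G →* ℂˣ) (ρ : Representation ℂ G V) : Representation ℂ G V where
  toFun g := (l g : ℂ) • ρ g
  map_one' := by simp
  map_mul' g h := by
    ext v
    simp only [map_mul, Units.val_mul, LinearMap.smul_apply, Module.End.mul_apply, map_smul,
      smul_smul, mul_comm]

theorem twistRep_apply (l : G →* ℂˣ) (ρ : Representation ℂ G V) (g : G) (v : V) :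
    twistRep l ρ g v = (l g : ℂ) • ρ g v := rfl

theorem twistRep_character (l : G →* ℂˣ) (ρ : Representation ℂ G V) :
    (twistRep l ρ).character = twist l ρ.character := by
  funext g
  change LinearMap.trace ℂ V ((l g : ℂ) • ρ g) = _
  rw [map_smul]
  rfl

/-- Twisting by a linear character does not change the subrepresentations. -/
noncomputable def subrepTwist (l : G →* ℂˣ) (ρ : Representation ℂ G V) :
    Subrepresentation (twistRep l ρ) ≃o Subrepresentation ρ where
  toFun W := ⟨W.toSubmodule, fun g v hv => by
    have := W.toSubmodule.smul_mem ((l g : ℂ)⁻¹) (W.apply_mem_toSubmodule g hv)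
    rwa [twistRep_apply, inv_smul_smul₀ (l g).ne_zero] at this⟩
  invFun W := ⟨W.toSubmodule, fun g _ hv =>
    W.toSubmodule.smul_mem _ (W.apply_mem_toSubmodule g hv)⟩
  left_inv _ := rfl
  right_inv _ := rfl
  map_rel_iff' := Iff.rfl

theorem twistRep_isIrreducible (l : G →* ℂˣ) (ρ : Representation ℂ G V)
    (hρ : ρ.IsIrreducible) : (twistRep l ρ).IsIrreducible :=
  (OrderIso.isSimpleOrder_iff (subrepTwist l ρ)).2 hρ

theorem twist_one (χ : G → ℂ) : twist 1 χ = χ := by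
  funext g; simp [twist]

theorem twist_mul (k l : G →* ℂˣ) (χ : G → ℂ) : twist (k * l) χ = twist k (twist l χ) := by
  funext g; simp [twist, mul_assoc]

theorem twist_inv_twist (l : G →* ℂˣ) (χ : G → ℂ) : twist l⁻¹ (twist l χ) = χ := by
  funext g
  simp [twist]

theorem twist_mem_Irr (l : G →* ℂˣ) {χ : G → ℂ} (h : χ ∈ Irr G) : twist l χ ∈ Irr G := by
  obtain ⟨n, ρ, hρ, rfl⟩ := h
  exact ⟨n, twistRep l ρ, twistRep_isIrreducible l ρ hρ, twistRep_character l ρ⟩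

theorem IsCharacter.twist (l : G →* ℂˣ) {χ : G → ℂ} (h : IsCharacter χ) :
    IsCharacter (twist l χ) := by
  obtain ⟨n, ρ, rfl⟩ := h
  exact ⟨n, twistRep l ρ, twistRep_character l ρ⟩

/-- Twisting commutes with induction. -/
theorem twist_ind [Fintype G] (l : G →* ℂˣ) (H : Subgroup G) (θ : H → ℂ) :
    twist l (ind H θ) = ind H (twist (l.comp H.subtype) θ) := by
  funext g
  simp only [twist, ind]
  rw [mul_left_comm, Finset.mul_sum]
  congr 1
  refine Finset.sum_congr rfl fun x _ => ?_
  -- `l` takes values in a commutative group, so it is constant on conjugacy classes.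
  have hx : l (x * g * x⁻¹) = l g := by
    rw [map_mul, map_mul, map_inv, mul_comm (l x), mul_inv_cancel_right]
  unfold extendZero
  split_ifs with h
  · rw [← hx]
    rfl
  · simp

theorem twist_mem_IrrPri [Fintype G] (l : G →* ℂˣ) {χ : G → ℂ} (h : χ ∈ IrrPri G) :
    twist l χ ∈ IrrPri G := by
  refine ⟨twist_mem_Irr l h.1, fun H hH θ hθ he => ?_⟩
  refine h.2 H hH (twist (l⁻¹.comp H.subtype) θ) (hθ.twist _) ?_
  rw [← twist_ind, ← he, twist_inv_twist]

theorem twist_mem_IrrQua (l : G →* ℂˣ) {χ : G → ℂ} (h : χ ∈ IrrQua G) :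
    twist l χ ∈ IrrQua G := by
  refine ⟨twist_mem_Irr l h.1, fun N hN => ?_⟩
  obtain ⟨ψ, hψ, a, ha⟩ := h.2 N hN
  refine ⟨twist (l.comp N.subtype) ψ, twist_mem_Irr _ hψ, a, ?_⟩
  funext n
  have := congrFun ha n
  simp only [res, Pi.smul_apply, nsmul_eq_mul, twist] at this ⊢
  rw [this, mul_left_comm]
  rfl

/-- A function fixed by twisting with `l` vanishes off the kernel of `l`. -/
theorem eq_zero_of_twist_eq {l : G →* ℂˣ} {χ : G → ℂ} (h : twist l χ = χ) {g : G}
    (hg : g ∉ l.ker) : χ g = 0 := by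
  by_contra h0
  refine hg (MonoidHom.mem_ker.2 (Units.ext ?_))
  simpa [twist, h0] using congrFun h g

end Twist

/-! ### Freeness on quasi-primitive characters -/

section QuasiPrimitive

variable {G : Type*} [Group G]

/-- Irreducible characters have norm one. -/
theorem sum_irr_mul_inv [Fintype G] {χ : G → ℂ} (h : χ ∈ Irr G) :
    ∑ g : G, χ g * χ g⁻¹ = Nat.card G := by
  obtain ⟨n, ρ, hρ, rfl⟩ := h
  have hne : (Nat.card G : ℂ) ≠ 0 := by exact_mod_cast Nat.card_pos.ne'
  have := invertibleOfNonzero hne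
  have h1 := Representation.char_orthonormal ρ ρ
  rw [if_pos ⟨Representation.Equiv.refl ρ⟩] at h1
  rwa [inv_mul_eq_iff_eq_mul₀ hne, mul_one] at h1

/-- If an irreducible character vanishes off a subgroup `N` and restricts to `a • ψ` with `ψ`
irreducible, then `|G : N| = a ^ 2`. -/
theorem index_eq_sq_of_res [Finite G] {χ : G → ℂ} (h : χ ∈ Irr G) (N : Subgroup G)
    (hv : ∀ g ∉ N, χ g = 0) {ψ : N → ℂ} (hψ : ψ ∈ Irr N) {a : ℕ} (ha : res N χ = a • ψ) :
    N.index = a ^ 2 := by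
  classical
  have := Fintype.ofFinite G
  have e1 := sum_irr_mul_inv h
  have e2 := sum_irr_mul_inv hψ
  have e3 : ∑ g : G, χ g * χ g⁻¹ = ∑ n : N, χ n * χ (n : G)⁻¹ := by
    rw [← Finset.sum_subset (Finset.subset_univ (Finset.univ.filter (· ∈ N)))]
    · exact Finset.sum_subtype _ (by simp) _
    · intro g _ hg
      rw [hv g (by simpa using hg), zero_mul]
  have e4 : ∑ n : N, χ n * χ (n : G)⁻¹ = (a : ℂ) ^ 2 * ∑ n : N, ψ n * ψ n⁻¹ := by
    rw [Finset.mul_sum]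
    refine Finset.sum_congr rfl fun n _ => ?_
    have h1 : χ n = a * ψ n := by simpa [res] using congrFun ha n
    have h2 : χ (n : G)⁻¹ = a * ψ n⁻¹ := by simpa [res] using congrFun ha n⁻¹
    rw [h1, h2]
    ring
  rw [e3, e4, e2, ← N.card_mul_index, Nat.cast_mul, mul_comm] at e1
  have hne : (Nat.card N : ℂ) ≠ 0 := by exact_mod_cast Nat.card_pos.ne'
  exact_mod_cast (mul_left_cancel₀ hne e1).symm

/-- A linear character of prime order has kernel of prime index. -/
theorem index_ker_of_orderOf_prime [Finite G] (l : G →* ℂˣ) (hl : (orderOf l).Prime) :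
    l.ker.index = orderOf l := by
  have : Finite l.range := Finite.of_surjective _ l.rangeRestrict_surjective
  have : IsCyclic l.range := isCyclic_subgroup_units l.range
  rw [Subgroup.index_ker]
  -- The image is a finite subgroup of `ℂˣ`, hence cyclic: its order is its exponent, which divides
  -- `orderOf l`.
  refine (Nat.dvd_prime hl).1 ?_ |>.resolve_left fun h1 => ?_
  · rw [← IsCyclic.exponent_eq_card]
    refine Monoid.exponent_dvd_of_forall_pow_eq_one ?_
    rintro ⟨_, g, rfl⟩
    refine Subtype.ext ?_
    exact DFunLike.congr_fun (pow_orderOf_eq_one l) g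
  · rw [Subgroup.card_eq_one, MonoidHom.range_eq_bot_iff] at h1
    rw [h1, orderOf_one] at hl
    exact Nat.not_prime_one hl

/-- Every power of `l` also fixes `χ`, so one may pass to a power of prime order, whose kernel has
prime index; `index_eq_sq_of_res` makes that index a square. -/
theorem eq_one_of_twist_eq_of_mem_IrrQua [Finite G] (l : G →* ℂˣ) {χ : G → ℂ}
    (h : χ ∈ IrrQua G) (hl : twist l χ = χ) : l = 1 := by
  by_contra hne
  have hpow : ∀ k : ℕ, twist (l ^ k) χ = χ := by
    intro k
    induction k with
    | zero => exact (congrArg (twist · χ) (pow_zero l)).trans (twist_one χ)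
    | succ k ih =>
      exact (congrArg (twist · χ) (pow_succ l k)).trans (by rw [twist_mul, hl, ih])
  obtain ⟨p, hp, hpd⟩ : ∃ p, p.Prime ∧ p ∣ orderOf l :=
    Nat.exists_prime_and_dvd fun h1 => hne ((orderOf_eq_one_iff (x := l)).1 h1)
  have hord : orderOf (l ^ (orderOf l / p)) = p := by
    refine orderOf_pow_orderOf_div ?_ hpd
    refine (orderOf_pos_iff.2 (isOfFinOrder_iff_pow_eq_one.2 ⟨Nat.card G, Nat.card_pos, ?_⟩)).ne'
    ext g
    simp [← map_pow]
  obtain ⟨ψ, hψ, a, ha⟩ := h.2 (l ^ (orderOf l / p)).ker inferInstance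
  have e := index_eq_sq_of_res h.1 _ (fun g hg => eq_zero_of_twist_eq (hpow _) hg) hψ ha
  rw [index_ker_of_orderOf_prime _ (by rwa [hord]), hord] at e
  exact hp.prime.not_isSquare ⟨a, by rw [e, sq]⟩

end QuasiPrimitive

/-! ### Freeness on primitive characters -/

section Primitive

variable {G V : Type*} [Group G] [AddCommGroup V] [Module ℂ V]

/-- The character of a finite-dimensional representation is a character. -/
theorem isCharacter_character [FiniteDimensional ℂ V] (ρ : Representation ℂ G V) :
    IsCharacter ρ.character := by
  let e : V ≃ₗ[ℂ] (Fin (Module.finrank ℂ V) → ℂ) := (Module.finBasis ℂ V).equivFun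
  let σ : Representation ℂ G (Fin (Module.finrank ℂ V) → ℂ) :=
    { toFun := fun g => e.conj (ρ g)
      map_one' := by rw [map_one]; exact e.conj_id
      map_mul' := fun g h => by rw [map_mul]; exact e.conj_comp _ _ }
  exact ⟨_, σ, funext fun g => LinearMap.trace_conj' (ρ g) e⟩

/-- An irreducible representation whose character is fixed by twisting with `l` carries an invertible
operator which intertwines it with its twist. -/
theorem exists_semicommuting_of_twist_eq [Finite G] [FiniteDimensional ℂ V]
    (ρ : Representation ℂ G V) (hρ : ρ.IsIrreducible) (l : G →* ℂˣ)
    (h : twist l ρ.character = ρ.character) :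
    ∃ T : V ≃ₗ[ℂ] V, ∀ g v, T (ρ g v) = (l g : ℂ) • ρ g (T v) := by
  classical
  have := Fintype.ofFinite G
  have hne : (Nat.card G : ℂ) ≠ 0 := by exact_mod_cast Nat.card_pos.ne'
  have := invertibleOfNonzero hne
  have := twistRep_isIrreducible l ρ hρ
  have h1 := Representation.char_orthonormal (twistRep l ρ) ρ
  have h2 := Representation.char_orthonormal ρ ρ
  rw [if_pos ⟨Representation.Equiv.refl ρ⟩] at h2
  -- The twist has the same character as `ρ`, so their pairing is `1`; by orthogonality they are
  -- isomorphic.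
  rw [twistRep_character, h, h2] at h1
  obtain ⟨φ⟩ : Nonempty (Representation.Equiv ρ (twistRep l ρ)) := by
    by_contra hn
    rw [if_neg hn] at h1
    exact one_ne_zero h1
  exact ⟨φ.toLinearEquiv, fun g v => LinearMap.congr_fun (φ.toIntertwiningMap.isIntertwining' g) v⟩

variable {ρ : Representation ℂ G V} {l : G →* ℂˣ} {T : V ≃ₗ[ℂ] V}

theorem apply_mem_eigenspace (hT : ∀ g v, T (ρ g v) = (l g : ℂ) • ρ g (T v)) (g : G) {z : ℂ}
    {v : V} (hv : v ∈ Module.End.eigenspace T.toLinearMap z) :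
    ρ g v ∈ Module.End.eigenspace T.toLinearMap ((l g : ℂ) * z) := by
  rw [Module.End.mem_eigenspace_iff] at hv ⊢
  rw [LinearEquiv.coe_coe] at hv ⊢
  rw [hT, hv, map_smul, mul_smul]

theorem apply_mem_eigenspace_of_mem_ker (hT : ∀ g v, T (ρ g v) = (l g : ℂ) • ρ g (T v)) {g : G}
    (hg : g ∈ l.ker) {z : ℂ} {v : V} (hv : v ∈ Module.End.eigenspace T.toLinearMap z) :
    ρ g v ∈ Module.End.eigenspace T.toLinearMap z := by
  have := apply_mem_eigenspace hT g hv
  rwa [MonoidHom.mem_ker.1 hg, Units.val_one, one_mul] at this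

/-- The kernel of `l` acts on each eigenspace of `T`. -/
noncomputable def eigenspaceRep (hT : ∀ g v, T (ρ g v) = (l g : ℂ) • ρ g (T v)) (z : ℂ) :
    Representation ℂ l.ker (Module.End.eigenspace T.toLinearMap z) where
  toFun g := (ρ g).restrict fun _ hv => apply_mem_eigenspace_of_mem_ker hT g.2 hv
  map_one' := by ext; simp
  map_mul' g h := by ext; simp

/-- `ρ x` carries one eigenspace isomorphically onto another. -/
noncomputable def eigenspaceEquiv (hT : ∀ g v, T (ρ g v) = (l g : ℂ) • ρ g (T v)) (z : ℂ)
    (x : G) : Module.End.eigenspace T.toLinearMap z ≃ₗ[ℂ]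
      Module.End.eigenspace T.toLinearMap ((l x : ℂ) * z) :=
  LinearEquiv.ofLinearMap
    ((ρ x).restrict fun _ hv => apply_mem_eigenspace hT x hv)
    ((ρ x⁻¹).restrict fun _ hv => by
      have := apply_mem_eigenspace hT x⁻¹ hv
      rwa [map_inv, Units.val_inv_eq_inv_val, inv_mul_cancel_left₀ (l x).ne_zero] at this)
    (by ext v; simp)
    (by ext v; simp)

/-- `ρ x` intertwines the action of `x⁻¹ * g * x` on one eigenspace with that of `g` on the other.
This turns the sum over conjugates in `ind` into a sum over eigenspaces. -/
theorem eigenspaceRep_character_conj [FiniteDimensional ℂ V]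
    (hT : ∀ g v, T (ρ g v) = (l g : ℂ) • ρ g (T v)) (z : ℂ)
    (x g : G) (hg : g ∈ l.ker) (hg' : x⁻¹ * g * x ∈ l.ker) :
    (eigenspaceRep hT z).character ⟨x⁻¹ * g * x, hg'⟩ =
      (eigenspaceRep hT ((l x : ℂ) * z)).character ⟨g, hg⟩ := by
  refine (LinearMap.trace_conj' _ (eigenspaceEquiv hT z x)).symm.trans ?_
  refine congrArg _ ?_
  ext v
  simp [eigenspaceEquiv, eigenspaceRep, LinearEquiv.conj_apply]

/-- `G` permutes these eigenspaces, so their sum is a nonzero subrepresentation. -/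
theorem iSup_eigenspace_eq_top (hρ : ρ.IsIrreducible)
    (hT : ∀ g v, T (ρ g v) = (l g : ℂ) • ρ g (T v)) {z : ℂ}
    (hz : Module.End.eigenspace T.toLinearMap z ≠ ⊥) :
    ⨆ i : l.range, Module.End.eigenspace T.toLinearMap (((i : ℂˣ) : ℂ) * z) = ⊤ := by
  let E : l.range → Submodule ℂ V :=
    fun i => Module.End.eigenspace T.toLinearMap (((i : ℂˣ) : ℂ) * z)
  have hE : ∀ g i v, v ∈ E i → ρ g v ∈ E (l.rangeRestrict g * i) := fun g i v hv => by
    have := apply_mem_eigenspace hT g hv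
    rwa [← mul_assoc] at this
  have hle : ∀ g, ⨆ i, E i ≤ (⨆ i, E i).comap (ρ g) := fun g =>
    iSup_le fun i v hv => Submodule.mem_iSup_of_mem _ (hE g i v hv)
  let W : Subrepresentation ρ := ⟨⨆ i, E i, fun g _ hv => hle g hv⟩
  have hW : W ≠ ⊥ := by
    intro h
    apply hz
    have h0 : ⨆ i, E i = ⊥ := congrArg Subrepresentation.toSubmodule h
    rw [eq_bot_iff, ← h0]
    refine le_trans (le_of_eq ?_) (le_iSup E 1)
    simp [E]
  exact congrArg Subrepresentation.toSubmodule ((hρ.eq_bot_or_eq_top W).resolve_left hW)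

theorem isInternal_eigenspace (hρ : ρ.IsIrreducible)
    (hT : ∀ g v, T (ρ g v) = (l g : ℂ) • ρ g (T v)) {z : ℂ} (hz0 : z ≠ 0)
    (hz : Module.End.eigenspace T.toLinearMap z ≠ ⊥) [DecidableEq l.range] :
    DirectSum.IsInternal fun i : l.range =>
      Module.End.eigenspace T.toLinearMap (((i : ℂˣ) : ℂ) * z) := by
  refine DirectSum.isInternal_submodule_of_iSupIndep_of_iSup_eq_top ?_
    (iSup_eigenspace_eq_top hρ hT hz)
  -- `z ≠ 0` makes the eigenvalues distinct, so the eigenspaces are independent.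
  have hinj : Function.Injective fun i : l.range => ((i : ℂˣ) : ℂ) * z := fun i j hij =>
    Subtype.ext (Units.ext (mul_right_cancel₀ hz0 hij))
  exact (Module.End.eigenspaces_iSupIndep T.toLinearMap).comp hinj

/-- Summing over `G` a function that factors through a homomorphism. -/
theorem sum_rangeRestrict {A : Type*} [Group A] [Fintype G] (f : G →* A) [Fintype f.range]
    (F : f.range → ℂ) : ∑ x : G, F (f.rangeRestrict x) = Nat.card f.ker * ∑ i, F i := by
  classical
  rw [← Finset.sum_fiberwise (s := Finset.univ) (g := f.rangeRestrict), Finset.mul_sum]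
  refine Finset.sum_congr rfl fun i _ => ?_
  rw [Finset.sum_congr rfl fun x hx => by rw [(Finset.mem_filter.1 hx).2], Finset.sum_const,
    nsmul_eq_mul]
  congr 2
  obtain ⟨y, rfl⟩ := f.rangeRestrict_surjective i
  rw [← Fintype.card_subtype, ← Nat.card_eq_fintype_card]
  refine Nat.card_congr ((Equiv.mulLeft y⁻¹).subtypeEquiv fun x => ?_)
  rw [Equiv.coe_mulLeft, MonoidHom.mem_ker, map_mul, map_inv, inv_mul_eq_one, Subtype.ext_iff,
    eq_comm]
  rfl

/-- An irreducible character fixed by twisting with `l` is induced from the kernel of `l`. -/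
theorem exists_eq_ind_ker_of_twist_eq [Fintype G] (l : G →* ℂˣ) {χ : G → ℂ} (h : χ ∈ Irr G)
    (hl : twist l χ = χ) : ∃ θ : l.ker → ℂ, IsCharacter θ ∧ χ = ind l.ker θ := by
  classical
  have hv := fun g hg => eq_zero_of_twist_eq (g := g) hl hg
  obtain ⟨n, ρ, hρ, rfl⟩ := h
  obtain ⟨T, hT⟩ := exists_semicommuting_of_twist_eq ρ hρ l hl
  have : Nontrivial (Fin n → ℂ) := by
    by_contra hn
    rw [not_nontrivial_iff_subsingleton] at hn
    obtain ⟨W, W', hWW⟩ := hρ.exists_pair_ne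
    exact hWW (Subrepresentation.toSubmodule_injective (Subsingleton.elim _ _))
  obtain ⟨z, hz⟩ := Module.End.exists_eigenvalue T.toLinearMap
  have hz0 : z ≠ 0 := by
    rintro rfl
    obtain ⟨v, hv⟩ := hz.exists_hasEigenvector
    have := hv.apply_eq_smul
    rw [zero_smul, LinearEquiv.coe_coe, LinearEquiv.map_eq_zero_iff] at this
    exact hv.2 this
  have hint := isInternal_eigenspace hρ hT hz0 hz
  refine ⟨_, isCharacter_character (eigenspaceRep hT z), funext fun g => ?_⟩
  by_cases hg : g ∈ l.ker
  · have hconj : ∀ x : G, x⁻¹ * g * x ∈ l.ker := fun x => by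
      simpa using (inferInstance : l.ker.Normal).conj_mem g hg x⁻¹
    have e1 : ρ.character g = ∑ i : l.range,
        (eigenspaceRep hT (((i : ℂˣ) : ℂ) * z)).character ⟨g, hg⟩ :=
      LinearMap.trace_eq_sum_trace_restrict hint
        fun i _ hv => apply_mem_eigenspace_of_mem_ker hT hg hv
    have e2 : ∑ x : G, extendZero l.ker (eigenspaceRep hT z).character (x * g * x⁻¹) =
        Nat.card l.ker * ρ.character g := by
      -- The eigenvalue `l x * z` depends only on the image of `x`, so each eigenspace is counted
      -- `|l.ker|` times. Inverting `x` matches the `x * g * x⁻¹` of `ind` with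
      -- `eigenspaceRep_character_conj`.
      rw [e1, ← sum_rangeRestrict, ← Equiv.sum_comp (Equiv.inv G)]
      refine Finset.sum_congr rfl fun x _ => ?_
      rw [Equiv.inv_apply, inv_inv, extendZero, dif_pos (hconj x)]
      exact eigenspaceRep_character_conj hT z x g hg (hconj x)
    rw [ind, e2, inv_mul_cancel_left₀]
    exact_mod_cast Nat.card_pos.ne'
  · rw [hv g hg, ind, Finset.sum_eq_zero, mul_zero]
    intro x _
    rw [extendZero, dif_neg]
    intro hx
    apply hg
    simpa [mul_assoc] using (inferInstance : l.ker.Normal).conj_mem _ hx x⁻¹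

theorem eq_one_of_twist_eq_of_mem_IrrPri [Fintype G] (l : G →* ℂˣ) {χ : G → ℂ}
    (h : χ ∈ IrrPri G) (hl : twist l χ = χ) : l = 1 := by
  by_contra hne
  obtain ⟨θ, hθ, he⟩ := exists_eq_ind_ker_of_twist_eq l h.1 hl
  exact h.2 l.ker (fun ht => hne (MonoidHom.ker_eq_top_iff.1 ht)) θ hθ he

end Primitive

end FinChar

theorem theorem2p8 (G : Type*) [Group G] [Fintype G] :
    (commutator G).index ∣ (FinChar.IrrPri G).ncard ∧
    (commutator G).index ∣ (FinChar.IrrQua G).ncard ∧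
    (commutator G).index ∣ Nat.gcd (FinChar.IrrPri G).ncard (FinChar.IrrQua G).ncard := by
  have hpri : (commutator G).index ∣ (FinChar.IrrPri G).ncard := by
    rw [← FinChar.card_linearCharacters]
    exact FinChar.card_dvd_ncard_of_free _ FinChar.twist FinChar.twist_one FinChar.twist_mul
      (fun l _ => FinChar.twist_mem_IrrPri l)
      (fun l _ => FinChar.eq_one_of_twist_eq_of_mem_IrrPri l)
  have hqua : (commutator G).index ∣ (FinChar.IrrQua G).ncard := by
    rw [← FinChar.card_linearCharacters]
    exact FinChar.card_dvd_ncard_of_free _ FinChar.twist FinChar.twist_one FinChar.twist_mul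
      (fun l _ => FinChar.twist_mem_IrrQua l)
      (fun l _ => FinChar.eq_one_of_twist_eq_of_mem_IrrQua l)
  exact ⟨hpri, hqua, Nat.dvd_gcd hpri hqua⟩
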